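/- **Setting.** A program $P$ is given by its control flow graph (CFG): finitely many nodes, one per statement, with two distinguished nodes ENTRY (no incoming edge) and EXIT; every statement is a skip, an assignment $x := e$ or a condition (two outgoing edges, labelled true and false); every node other than a condition and EXIT has exactly one outgoing edge; EXIT is reachable in the graph from every node. (Jumps such as break and continue are edges; procedure calls are summarised by assignments.) For paths and post-dominance the special edges ENTRY $\to$ EXIT and EXIT $\to$ EXIT are added. A trace on input $I$ is a finite execution from $\langle \mathrm{ENTRY}, I\rangle$ to EXIT, i.e. traces are terminating. Let $l$ be a node other than ENTRY and $V$ a set of variables. The augmented program $P^A$ is $P$ with a SKIP statement inserted immediately before $l$; from now on $l$ denotes this SKIP, and $\Upsilon=\langle l,V\rangle$ is the slicing criterion. All notions below refer to $P^A$. $DU(q,X)$ is the set of assignments to a variable $v\in X$ from which some path leads to $q$ with no other definition of $v$ strictly in between, and $REF(t)$ is the set of variables read by $t$. The set $VI(\Upsilon)$ of *value-impacting* statements is the least set such that: (1) $l\in VI(\Upsilon)$; (2) $DU(l,V)\subseteq VI(\Upsilon)$; (3) $DU(t,REF(t))\subseteq VI(\Upsilon)$ for every $t\in VI(\Upsilon)$;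 (4) a condition $c$ is in $VI(\Upsilon)$ if there are paths $\pi_1,\pi_2$ to $l$ starting with different outgoing edges of $c$, and $t\in VI(\Upsilon)$, such that $t$ is the first element of $VI(\Upsilon)$ after $c$ on $\pi_1$ but not on $\pi_2$. A node $n_2$ post-dominates $n_1$ if every path from $n_1$ to EXIT contains $n_2$, and strictly so if moreover $n_1\ne n_2$; $s$ is strongly control dependent on $c$ if for some edge $c\to m$, $s$ post-dominates $m$ and does not strictly post-dominate $c$; write $c\longrightarrow s$ for the transitive closure. Let $AC(\Upsilon)=\{c \text{ a condition} : c\longrightarrow t \text{ for some } t\in VI(\Upsilon)\}\setminus VI(\Upsilon)$. Let $P^S$ be obtained from $P^A$ by retaining exactly the statements in $VI(\Upsilon)\cup AC(\Upsilon)$ (and ENTRY, EXIT), bypassing the deleted statements, and replacing each condition in $AC(\Upsilon)$ by a nondeterministic choice of branch. **Theorem 1.** $P^S$ is a data slice for $\Upsilon$, that is: 1. $P^S$ is an abstract subprogram of $P^A$ that contains the SKIP at $l$: it is a program (in particular, every outgoing edge of a retained statement has exactly one target after the bypassing); its statements are statements of $P^A$ or abstract (nondeterministic) versions of them; its edges are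 those of $P^A$ with deleted statements bypassed; and if a statement $n$ of $P^S$ satisfies $c\longrightarrow n$ in $P^A$ for a condition $c$, then $c$ is in $P^S$ and $c\longrightarrow n$ in $P^S$. 2. For every input $I$ and every trace $\tau$ of $P^A$ on $I$ there is a trace $\tau'$ of $P^S$ on $I$ such that the sequences of the $V$-restrictions of the program states at the successive visits of $l$ are equal for $\tau$ and $\tau'$. 3. For every input $I$ and all traces $\tau$ of $P^A$ and $\tau'$ of $P^S$ on $I$: whenever both visit $l$ at least $i$ times, the program states at the $i$-th visit of $l$ in $\tau$ and in $\tau'$ agree on $V$. -/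

import Mathlib

/-! Programs are control flow graphs whose nodes are labelled statements. -/

/-- An expression: the variables it refers to and the operation applied to their values.
Values of pure function calls are covered, since `op` is arbitrary. -/
structure Expr (Var Val T : Type*) where
  args : List Var
  op : List Val → T

/-- Value of an expression in a program state. -/
def Expr.eval {Var Val T : Type*} (e : Expr Var Val T) (σ : Var → Val) : T :=
  e.op (e.args.map σ)

/-- Statements. `havoc x` is the abstract assignment `x = *`,
`star` is the abstract conditional `*`. -/
inductive Stmt (Var Val : Type*) where
  | skip : Stmt Var Val
  | assign (x : Var) (e : Expr Var Val Val) : Stmt Var Val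
  | cond (e : Expr Var Val Bool) : Stmt Var Val
  | havoc (x : Var) : Stmt Var Val
  | star : Stmt Var Val

namespace Stmt

variable {Var Val : Type*}

/-- `REF`: the variables whose value is referred to. -/
def ref : Stmt Var Val → Set Var
  | skip => ∅
  | assign _ e => {v | v ∈ e.args}
  | cond e => {v | v ∈ e.args}
  | havoc _ => ∅
  | star => ∅

/-- The statement is an assignment to `v`. -/
def Defines : Stmt Var Val → Var → Prop
  | assign x _, v => x = v
  | havoc x, v => x = v
  | _, _ => False

/-- The statement is a (concrete or abstract) condition. -/
def IsCondition : Stmt Var Val → Prop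
  | cond _ => True
  | star => True
  | _ => False

/-- Neither an abstract assignment nor an abstract condition. -/
def IsConcrete : Stmt Var Val → Prop
  | havoc _ => False
  | star => False
  | _ => True

/-- The second statement is the first one, or its abstract version. -/
inductive Abstracts : Stmt Var Val → Stmt Var Val → Prop
  | same (s : Stmt Var Val) : Abstracts s s
  | assign (x : Var) (e : Expr Var Val Val) : Abstracts (.assign x e) (.havoc x)
  | cond (e : Expr Var Val Bool) : Abstracts (.cond e) .star

end Stmt

/-- A program, given by its control flow graph. `edge n none m` is an unconditional edge,
`edge n (some b) m` is the edge taken when the condition `n` evaluates to `b`.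
`break` and `continue` are represented by the edges that they induce.
The two special edges ENTRY → EXIT and EXIT → EXIT are added in `Program.Flow`. -/
structure Program (L Var Val : Type*) where
  nodes : Set L
  entry : L
  exit : L
  stmt : L → Stmt Var Val
  edge : L → Option Bool → L → Prop

namespace Program

variable {L Var Val : Type*}

/-- Successor relation of the control flow graph, special edges included. -/
def Flow (P : Program L Var Val) (n m : L) : Prop :=
  (∃ b, P.edge n b m) ∨ (n = P.entry ∧ m = P.exit) ∨ (n = P.exit ∧ m = P.exit)

/-- `P.Path n m p`: the list `p` of nodes is a path from `n` to `m`. -/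
inductive Path (P : Program L Var Val) : L → L → List L → Prop
  | single (n : L) : Path P n n [n]
  | step {n k m : L} {p : List L} : P.Flow n k → Path P k m p → Path P n m (n :: p)

/-- The control flow graph is one of a program: finitely many statements, no edge into ENTRY,
no proper edge out of EXIT, one successor for each outcome of a condition and one for every
other statement, and EXIT can be reached in the graph from every node. -/
structure WellFormed (P : Program L Var Val) : Prop where
  finite : P.nodes.Finite
  entry_mem : P.entry ∈ P.nodes
  exit_mem : P.exit ∈ P.nodes
  entry_ne_exit : P.entry ≠ P.exit
  stmt_entry : P.stmt P.entry = .skip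
  stmt_exit : P.stmt P.exit = .skip
  edge_mem : ∀ n b m, P.edge n b m → n ∈ P.nodes ∧ m ∈ P.nodes
  edge_ne_entry : ∀ n b m, P.edge n b m → m ≠ P.entry
  edge_ne_exit : ∀ n b m, P.edge n b m → n ≠ P.exit
  edge_label : ∀ n b m, P.edge n b m → (b ≠ none ↔ (P.stmt n).IsCondition)
  edge_cond : ∀ n ∈ P.nodes, (P.stmt n).IsCondition → ∀ b : Bool, ∃! m, P.edge n (some b) m
  edge_uncond : ∀ n ∈ P.nodes, n ≠ P.exit → ¬ (P.stmt n).IsCondition → ∃! m, P.edge n none m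
  exit_reachable : ∀ n ∈ P.nodes, ∃ p, P.Path n P.exit p

/-- All statements are concrete. -/
def IsConcrete (P : Program L Var Val) : Prop :=
  ∀ n ∈ P.nodes, (P.stmt n).IsConcrete

/-! ### Execution -/

/-- One execution step between execution states (node, program state). -/
inductive Step (P : Program L Var Val) : L × (Var → Val) → L × (Var → Val) → Prop
  | skip {n m : L} {σ : Var → Val} : P.stmt n = .skip → P.edge n none m →
      Step P (n, σ) (m, σ)
  | assign {n m : L} {x : Var} {e : Expr Var Val Val} {σ σ' : Var → Val} :
      P.stmt n = .assign x e → P.edge n none m →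
      σ' x = e.eval σ → (∀ y, y ≠ x → σ' y = σ y) → Step P (n, σ) (m, σ')
  | cond {n m : L} {e : Expr Var Val Bool} {σ : Var → Val} :
      P.stmt n = .cond e → P.edge n (some (e.eval σ)) m → Step P (n, σ) (m, σ)
  | havoc {n m : L} {x : Var} {σ σ' : Var → Val} :
      P.stmt n = .havoc x → P.edge n none m →
      (∀ y, y ≠ x → σ' y = σ y) → Step P (n, σ) (m, σ')
  | star {n m : L} {b : Bool} {σ : Var → Val} :
      P.stmt n = .star → P.edge n (some b) m → Step P (n, σ) (m, σ)

/-- `τ` is a (terminating) trace of `P` on the input (the initial program state) `I`. -/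
def IsTrace (P : Program L Var Val) (I : Var → Val) (τ : List (L × (Var → Val))) : Prop :=
  τ.head? = some (P.entry, I) ∧ τ.IsChain P.Step ∧ ∃ θ, τ.getLast? = some (P.exit, θ)

end Program

open Classical in
/-- Trace window of observation for `⟨l, V⟩`: the sequence of the `V`-restrictions of the
program states of the SC-execution states (those at `l`). -/
noncomputable def traceWindow {L Var Val : Type*} (l : L) (V : Set Var)
    (τ : List (L × (Var → Val))) : List (V → Val) :=
  (τ.filter (fun s => s.1 = l)).map (fun s v => s.2 v)

/-- `t` is the first element of `p` that belongs to `W`. -/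
def FirstIn {L : Type*} (W : Set L) (t : L) (p : List L) : Prop :=
  ∃ as bs, p = as ++ t :: bs ∧ (∀ a ∈ as, a ∉ W) ∧ t ∈ W

namespace Program

variable {L Var Val : Type*}

/-! ### Data and control dependence -/

/-- The definition of `v` at `d` reaches `q`: there is a path from `d` to `q` with no other
definition of `v` strictly in between. -/
def ReachingDef (P : Program L Var Val) (d : L) (v : Var) (q : L) : Prop :=
  (P.stmt d).Defines v ∧ ∃ k p, P.Flow d k ∧ P.Path k q p ∧
    ∀ n ∈ p.dropLast, ¬ (P.stmt n).Defines v

/-- `DU(q, X)`: the assignments to variables in `X` that reach `q`. -/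
def DU (P : Program L Var Val) (q : L) (X : Set Var) : Set L :=
  {d | ∃ v ∈ X, P.ReachingDef d v q}

/-- `n₂` (weakly) post-dominates `n₁`. -/
def PostDominates (P : Program L Var Val) (n₂ n₁ : L) : Prop :=
  ∀ p, P.Path n₁ P.exit p → n₂ ∈ p

/-- `n₂` strictly (weakly) post-dominates `n₁`. -/
def StrictlyPostDominates (P : Program L Var Val) (n₂ n₁ : L) : Prop :=
  P.PostDominates n₂ n₁ ∧ n₁ ≠ n₂

/-- `s` is strongly control dependent on some edge out of `n`. -/
def ControlDep (P : Program L Var Val) (n s : L) : Prop :=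
  ∃ m, P.Flow n m ∧ P.PostDominates s m ∧ ¬ P.StrictlyPostDominates s n

/-- `c ⟶ s`: `s` is strongly transitively control dependent on `c`. -/
def TransControlDep (P : Program L Var Val) (c s : L) : Prop :=
  Relation.TransGen P.ControlDep c s

/-! ### Value-impacting statements and the remaining controlling conditions -/

/-- The set `W` is closed under the rules that define the statements which value-impact
`⟨l, V⟩`, where `l` is the label of the inserted SKIP statement. -/
structure ValueImpactClosed (P : Program L Var Val) (l : L) (V : Set Var) (W : Set L) :
    Prop where
  skip : l ∈ W
  crit : ∀ s ∈ P.DU l V, s ∈ W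
  data : ∀ t ∈ W, ∀ s ∈ P.DU t (P.stmt t).ref, s ∈ W
  cond : ∀ c ∈ P.nodes, (P.stmt c).IsCondition →
    (∃ b₁ b₂ m₁ m₂ p₁ p₂ t, b₁ ≠ b₂ ∧
      P.edge c (some b₁) m₁ ∧ P.Path m₁ l p₁ ∧
      P.edge c (some b₂) m₂ ∧ P.Path m₂ l p₂ ∧
      FirstIn W t p₁ ∧ ¬ FirstIn W t p₂) → c ∈ W

/-- `VI(⟨l, V⟩)`: the least set closed under the rules. -/
def VI (P : Program L Var Val) (l : L) (V : Set Var) : Set L :=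
  {s | ∀ W, P.ValueImpactClosed l V W → s ∈ W}

/-- Along paths to `l`, a node outside a closed set determines the first element of the set. -/
theorem ValueImpactClosed.firstIn_unique {P : Program L Var Val} (hP : P.WellFormed)
    {l : L} (hl : l ≠ P.exit) {V : Set Var} {W : Set L} (hW : P.ValueImpactClosed l V W)
    {n : L} {p : List L} (hp : P.Path n l p) :
    n ∉ W → ∀ {q : List L}, P.Path n l q → ∃ u a b a' b', p = a ++ u :: b ∧
      q = a' ++ u :: b' ∧ u ∈ W ∧ (∀ x ∈ a, x ∉ W) ∧ (∀ x ∈ a', x ∉ W) ∧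
      P.Path u l (u :: b) ∧ P.Path u l (u :: b') ∧ a ≠ [] := by
  have head : ∀ {n m : L} {p : List L}, P.Path n m p → ∃ r, p = n :: r := by
    intro n m p h
    cases h
    · exact ⟨[], rfl⟩
    · exact ⟨_, rfl⟩
  have first : ∀ {n m : L} {p : List L}, P.Path n m p → m = l → ∃ u, FirstIn W u p := by
    intro n m p h
    induction h with
    | single n => rintro rfl; exact ⟨n, [], [], rfl, by simp, hW.skip⟩
    | @step n k m p hf hp ih =>
      intro hm
      by_cases hn : n ∈ W
      · exact ⟨n, [], p, rfl, by simp, hn⟩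
      · obtain ⟨u, a, b, rfl, ha, hu⟩ := ih hm
        exact ⟨u, n :: a, b, rfl, by simpa [hn] using ha, hu⟩
  have suffix : ∀ {m : L} {p : List L} {n : L}, P.Path n m p → ∀ a u b, p = a ++ u :: b →
      P.Path u m (u :: b) := by
    intro m p n h
    induction h with
    | single n =>
      intro a u b h
      rcases a with _ | ⟨x, a⟩
      · simp only [List.nil_append, List.cons.injEq] at h
        obtain ⟨rfl, rfl⟩ := h
        exact .single n
      · simp at h
    | @step n k m p hf hp ih =>
      intro a u b h
      rcases a with _ | ⟨x, a⟩
      · simp only [List.nil_append, List.cons.injEq] at h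
        obtain ⟨rfl, rfl⟩ := h
        exact .step hf hp
      · simp only [List.cons_append, List.cons.injEq] at h
        exact ih a u b h.2
  have nexit : ∀ {n m : L} {p : List L}, P.Path n m p → n = P.exit → m = P.exit := by
    intro n m p h
    induction h with
    | single n => exact id
    | step hf hp ih =>
      rintro rfl
      rcases hf with ⟨b, hb⟩ | ⟨_, rfl⟩ | ⟨_, rfl⟩
      · exact absurd rfl (hP.edge_ne_exit _ _ _ hb)
      · exact ih rfl
      · exact ih rfl
  have real : ∀ {n k : L} {p : List L}, P.Flow n k → P.Path k l p → ∃ b, P.edge n b k := by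
    intro n k p hf hp
    rcases hf with h | ⟨_, rfl⟩ | ⟨_, rfl⟩
    · exact h
    · exact absurd (nexit hp rfl) hl
    · exact absurd (nexit hp rfl) hl
  -- it suffices to find a common first element
  suffices H : n ∉ W → ∀ {q : List L}, P.Path n l q →
      ∃ u, FirstIn W u p ∧ FirstIn W u q by
    intro hn q hq
    obtain ⟨u, ⟨a, b, rfl, ha, hu⟩, ⟨a', b', rfl, ha', -⟩⟩ := H hn hq
    refine ⟨u, a, b, a', b', rfl, rfl, hu, ha, ha', suffix hp _ _ _ rfl,
      suffix hq _ _ _ rfl, ?_⟩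
    rintro rfl
    obtain ⟨r, hr⟩ := head hp
    simp only [List.nil_append, List.cons.injEq] at hr
    exact hn (hr.1 ▸ hu)
  have cons : ∀ {n u : L} {p : List L}, n ∉ W → FirstIn W u p → FirstIn W u (n :: p) := by
    rintro n u p hn ⟨a, b, rfl, ha, hu⟩
    exact ⟨n :: a, b, rfl, by simpa [hn] using ha, hu⟩
  generalize hl' : l = l' at hp
  induction hp with
  | single n => intro hn; exact absurd (hl' ▸ hW.skip) hn
  | @step n k m p hf hp ih =>
    subst hl'
    intro hn q hq
    cases hq with
    | single => exact absurd hW.skip hn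
    | @step _ k' _ q hf' hq =>
      obtain ⟨b, hb⟩ := real hf hp
      obtain ⟨b', hb'⟩ := real hf' hq
      obtain ⟨t, ht⟩ := first hp rfl
      by_cases hbb : b = b'
      · subst hbb
        have hk : k = k' := by
          have hmem := (hP.edge_mem _ _ _ hb).1
          rcases b with _ | b
          · have hc : ¬ (P.stmt n).IsCondition := fun h => (hP.edge_label _ _ _ hb).2 h rfl
            exact (hP.edge_uncond n hmem (hP.edge_ne_exit _ _ _ hb) hc).unique hb hb'
          · exact (hP.edge_cond n hmem ((hP.edge_label _ _ _ hb).1 (by simp)) b).unique hb hb'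
        subst hk
        by_cases hkW : k ∈ W
        · obtain ⟨r, rfl⟩ := head hp
          obtain ⟨r', rfl⟩ := head hq
          exact ⟨k, cons hn ⟨[], r, rfl, by simp, hkW⟩, cons hn ⟨[], r', rfl, by simp, hkW⟩⟩
        · obtain ⟨u, h1, h2⟩ := ih rfl hkW hq
          exact ⟨u, cons hn h1, cons hn h2⟩
      · refine ⟨t, cons hn ht, cons hn ?_⟩
        by_contra hnot
        apply hn
        have hbn : b ≠ none ∧ b' ≠ none := by
          constructor
          · intro h
            have := (hP.edge_label _ _ _ hb').1 (fun h' => hbb (h.trans h'.symm))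
            exact (hP.edge_label _ _ _ hb).2 this h
          · intro h
            have := (hP.edge_label _ _ _ hb).1 (fun h' => hbb (h'.trans h.symm))
            exact (hP.edge_label _ _ _ hb').2 this h
        have hc := (hP.edge_label _ _ _ hb).1 hbn.1
        obtain ⟨c, rfl⟩ := Option.ne_none_iff_exists'.1 hbn.1
        obtain ⟨c', rfl⟩ := Option.ne_none_iff_exists'.1 hbn.2
        exact hW.cond n (hP.edge_mem _ _ _ hb).1 hc
          ⟨c, c', k, k', p, q, t, fun h => hbb (h ▸ rfl), hb, hp, hb', hq, ht, hnot⟩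

/-- The rule for conditions is not monotone in the set, but `VI` is nevertheless closed under
the rules, hence the least closed set. -/
theorem valueImpactClosed_VI {P : Program L Var Val} (hP : P.WellFormed)
    {l : L} (hl : l ≠ P.exit) (V : Set Var) : P.ValueImpactClosed l V (P.VI l V) := by
  have key : ∀ (N : ℕ) {n : L} {p q : List L}, p.length ≤ N → P.Path n l p → P.Path n l q →
      ∃ u, FirstIn (P.VI l V) u p ∧ FirstIn (P.VI l V) u q := by
    have head : ∀ {n m : L} {p : List L}, P.Path n m p → ∃ r, p = n :: r := by
      intro n m p h
      cases h
      · exact ⟨[], rfl⟩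
      · exact ⟨_, rfl⟩
    intro N
    induction N with
    | zero =>
      intro n p q h hp
      obtain ⟨r, rfl⟩ := head hp
      simp at h
    | succ N ih =>
      intro n p q h hp hq
      by_cases hn : n ∈ P.VI l V
      · obtain ⟨r, rfl⟩ := head hp
        obtain ⟨r', rfl⟩ := head hq
        exact ⟨n, ⟨[], r, rfl, by simp, hn⟩, ⟨[], r', rfl, by simp, hn⟩⟩
      · have hn' := hn
        simp only [VI, Set.mem_ofPred_eq, not_forall] at hn'
        obtain ⟨W, hW, hnW⟩ := hn'
        obtain ⟨u, a, b, a', b', rfl, rfl, -, ha, ha', h1, h2, hne⟩ :=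
          hW.firstIn_unique hP hl hp hnW hq
        have hlen : (u :: b).length ≤ N := by
          have := List.length_pos_of_ne_nil hne
          simp only [List.length_append] at h
          omega
        obtain ⟨v, ⟨c, d, e1, hc, hv⟩, ⟨c', d', e1', hc', -⟩⟩ := ih hlen h1 h2
        have sub : ∀ x, x ∉ W → x ∉ P.VI l V := fun x hx hxv => hx (hxv W hW)
        refine ⟨v, ⟨a ++ c, d, by rw [e1, List.append_assoc], ?_, hv⟩,
          ⟨a' ++ c', d', by rw [e1', List.append_assoc], ?_, hv⟩⟩
        · intro x hx
          rcases List.mem_append.1 hx with hx | hx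
          · exact sub x (ha x hx)
          · exact hc x hx
        · intro x hx
          rcases List.mem_append.1 hx with hx | hx
          · exact sub x (ha' x hx)
          · exact hc' x hx
  have uniq : ∀ {t u : L} {W : Set L} {p : List L}, FirstIn W t p → FirstIn W u p → t = u := by
    rintro t u W p ⟨a, b, rfl, ha, ht⟩ ⟨a', b', h, ha', hu⟩
    induction a generalizing a' with
    | nil =>
      rcases a' with _ | ⟨x, a'⟩
      · simp only [List.nil_append, List.cons.injEq] at h
        exact h.1
      · simp only [List.nil_append, List.cons_append, List.cons.injEq] at h
        exact absurd (h.1 ▸ ht) (ha' x (by simp))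
    | cons y a ih =>
      rcases a' with _ | ⟨x, a'⟩
      · simp only [List.nil_append, List.cons_append, List.cons.injEq] at h
        exact absurd (h.1 ▸ hu) (ha y (by simp))
      · simp only [List.cons_append, List.cons.injEq] at h
        exact ih (fun x hx => ha x (by simp [hx])) _ h.2 (fun x hx => ha' x (by simp [hx]))
  refine ⟨fun W hW => hW.skip, fun s hs W hW => hW.crit s hs,
    fun t ht s hs W hW => hW.data t (ht W hW) s hs, ?_⟩
  rintro c hc hcc ⟨b₁, b₂, m₁, m₂, p₁, p₂, t, hb, he₁, hp₁, he₂, hp₂, ht, hnt⟩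
  by_contra hcV
  have h1 : P.Path c l (c :: p₁) := .step (Or.inl ⟨_, he₁⟩) hp₁
  have h2 : P.Path c l (c :: p₂) := .step (Or.inl ⟨_, he₂⟩) hp₂
  obtain ⟨u, ⟨a, b, ha, hau, hu⟩, ⟨a', b', ha', hau', -⟩⟩ := key _ le_rfl h1 h2
  have drop : ∀ {a b p : List L}, c :: p = a ++ u :: b → (∀ x ∈ a, x ∉ P.VI l V) →
      FirstIn (P.VI l V) u p := by
    intro a b p h hx
    rcases a with _ | ⟨x, a⟩
    · simp only [List.nil_append, List.cons.injEq] at h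
      exact absurd (h.1 ▸ hu) hcV
    · simp only [List.cons_append, List.cons.injEq] at h
      exact ⟨a, b, h.2, fun y hy => hx y (by simp [hy]), hu⟩
  have e := uniq ht (drop ha hau)
  subst e
  exact hnt (drop ha' hau')

/-- `AC(⟨l, V⟩)`: the conditions that are not value-impacting, but on which value-impacting
statements are strongly transitively control dependent. -/
def AC (P : Program L Var Val) (l : L) (V : Set Var) : Set L :=
  {c | c ∈ P.nodes ∧ (P.stmt c).IsCondition ∧ ∃ t ∈ P.VI l V, P.TransControlDep c t} \ P.VI l V

/-! ### Subprograms -/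

/-- After deleting the nodes outside `N`, there is an edge from `n` to `m` with label `b`:
the original edge out of `n`, followed by a path through deleted nodes only, leads to `m`. -/
def Bypass (P : Program L Var Val) (N : Set L) (n : L) (b : Option Bool) (m : L) : Prop :=
  ∃ k p, P.edge n b k ∧ P.Path k m p ∧ (∀ a ∈ p.dropLast, a ∉ N) ∧ m ∈ N

/-- `Q` is an abstract subprogram of `P`: a program obtained by deleting statements, and by
replacing some of the others by their abstract versions, in which every statement remains
under the conditions that govern it in `P`. -/
structure IsAbstractSubprogram (Q P : Program L Var Val) : Prop where
  wellFormed : Q.WellFormed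
  nodes_subset : Q.nodes ⊆ P.nodes
  entry_eq : Q.entry = P.entry
  exit_eq : Q.exit = P.exit
  stmt_abstracts : ∀ n ∈ Q.nodes, Stmt.Abstracts (P.stmt n) (Q.stmt n)
  edge_iff : ∀ n ∈ Q.nodes, ∀ b m, Q.edge n b m ↔ P.Bypass Q.nodes n b m
  structure_intact : ∀ n ∈ Q.nodes, ∀ c ∈ P.nodes, (P.stmt c).IsCondition →
    P.TransControlDep c n → c ∈ Q.nodes ∧ Q.TransControlDep c n

/-- `Q` is a data slice of the augmented program `A` for the criterion `⟨l, V⟩`, where `l` is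
the label of the inserted SKIP statement. -/
structure IsDataSlice (Q A : Program L Var Val) (l : L) (V : Set Var) : Prop where
  isAbstractSubprogram : Q.IsAbstractSubprogram A
  skip_retained : l ∈ Q.nodes ∧ Q.stmt l = .skip
  exists_equivalent : ∀ I τ, A.IsTrace I τ →
    ∃ τ', Q.IsTrace I τ' ∧ traceWindow l V τ = traceWindow l V τ'
  corresponding_agree : ∀ I τ τ', A.IsTrace I τ → Q.IsTrace I τ' →
    ∀ (i : ℕ) (w w' : V → Val), (traceWindow l V τ)[i]? = some w →
      (traceWindow l V τ')[i]? = some w' → w = w'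

/-- The augmented program: a SKIP statement with label `sk` is inserted at the location `l`,
so that it is executed just before each execution of `l`. -/
noncomputable def augment (P : Program L Var Val) (l sk : L) : Program L Var Val where
  nodes := insert sk P.nodes
  entry := P.entry
  exit := P.exit
  stmt := open Classical in Function.update P.stmt sk .skip
  edge n b m := (P.edge n b m ∧ m ≠ l) ∨ (P.edge n b l ∧ m = sk) ∨ (n = sk ∧ b = none ∧ m = l)

/-- `P^S`: the statements in `VI ∪ AC` (with ENTRY and EXIT), where the conditions in `AC`
are made nondeterministic. -/
noncomputable def slice (P : Program L Var Val) (l : L) (V : Set Var) : Program L Var Val where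
  nodes := P.VI l V ∪ P.AC l V ∪ {P.entry, P.exit}
  entry := P.entry
  exit := P.exit
  stmt n := open Classical in if n ∈ P.AC l V then .star else P.stmt n
  edge n b m := n ∈ P.VI l V ∪ P.AC l V ∪ {P.entry, P.exit} ∧
    P.Bypass (P.VI l V ∪ P.AC l V ∪ {P.entry, P.exit}) n b m

end Program

/-! Well-formedness of the slice and preservation of control dependence rest on one fact: the
retained set is closed backwards under control dependence (`WellFormed.mem_retained_of_controlDep`).
If a walk through deleted nodes from `k` ends at a retained `u`, then `u` post-dominates `k`;
otherwise some deleted node on the walk would control `u`. Two distinct retained nodes cannot both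
be reached in this way: each would lie behind the other on every path to EXIT, and such paths would
shrink forever. So bypassing has a unique target (`WellFormed.via_retained_unique`). Paths avoiding
a retained node transfer between program and slice, so post-dominance and control dependence among
retained nodes survive.

The dynamic claims use the variables that are `relevant` at a node, a form of liveness with respect
to `VI`. By the two data rules, any definition of a relevant variable is value-impacting, so other
nodes leave relevant values unchanged. For existence, the slice follows a given trace, skips its
deleted nodes and resolves each `star` as the trace did, while agreement on relevant variables is
maintained (`WellFormed.exists_slice_chain`).

For agreement of arbitrary traces, the nondeterministic choices cannot matter: by the condition
rule, the first value-impacting node on the way to `l` does not depend on the route. Two runs that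
both still visit `l` therefore meet at the same value-impacting node with equal relevant values,
execute the same statement there and leave by the same edge (`WellFormed.window_agree`). -/

namespace Program

variable {L Var Val : Type*}

/-! ### Paths whose nodes, except the last one, satisfy a condition -/

/-- There is a path from `n` to `m` all of whose nodes before the last one satisfy `C`. -/
def Via (P : Program L Var Val) (C : L → Prop) : L → L → Prop :=
  Relation.ReflTransGen fun a b => C a ∧ P.Flow a b

theorem Via.mono {P : Program L Var Val} {C D : L → Prop} (h : ∀ a, C a → D a) {n m : L}
    (hv : P.Via C n m) : P.Via D n m :=
  Relation.ReflTransGen.mono (fun _ _ hab => ⟨h _ hab.1, hab.2⟩) _ _ hv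

theorem Via.cons {P : Program L Var Val} {C : L → Prop} {n k m : L} (hn : C n)
    (hf : P.Flow n k) (hv : P.Via C k m) : P.Via C n m :=
  Relation.ReflTransGen.head ⟨hn, hf⟩ hv

theorem Via.eq_of_not {P : Program L Var Val} {C : L → Prop} {n m : L}
    (hv : P.Via C n m) (hn : ¬ C n) : m = n := by
  rcases Relation.ReflTransGen.cases_head hv with h | ⟨_, h, _⟩
  · exact h.symm
  · exact absurd h.1 hn

theorem Path.ne_nil {P : Program L Var Val} {n m : L} {p : List L} (h : P.Path n m p) :
    p ≠ [] := by
  cases h <;> simp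

theorem Path.head_mem {P : Program L Var Val} {n m : L} {p : List L} (h : P.Path n m p) :
    n ∈ p := by
  cases h <;> simp

theorem Path.last_mem {P : Program L Var Val} {n m : L} {p : List L} (h : P.Path n m p) :
    m ∈ p := by
  induction h with
  | single => simp
  | step _ _ ih => exact List.mem_cons_of_mem _ ih

theorem Path.mem_dropLast_or {P : Program L Var Val} {n m a : L} {p : List L}
    (h : P.Path n m p) (ha : a ∈ p) : a ∈ p.dropLast ∨ a = m := by
  induction h with
  | single => simpa using ha
  | step hf hp ih =>
    rw [List.dropLast_cons_of_ne_nil hp.ne_nil]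
    rcases List.mem_cons.1 ha with rfl | ha
    · simp
    · rcases ih ha with h | h
      · exact .inl (List.mem_cons_of_mem _ h)
      · exact .inr h

theorem via_iff_exists_path {P : Program L Var Val} {C : L → Prop} {n m : L} :
    P.Via C n m ↔ ∃ p, P.Path n m p ∧ ∀ a ∈ p.dropLast, C a := by
  constructor
  · intro h
    induction h using Relation.ReflTransGen.head_induction_on with
    | refl => exact ⟨_, .single _, by simp⟩
    | head h _ ih =>
      obtain ⟨p, hp, hC⟩ := ih
      refine ⟨_, .step h.2 hp, ?_⟩
      rw [List.dropLast_cons_of_ne_nil hp.ne_nil]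
      simpa [h.1] using hC
  · rintro ⟨p, hp, hC⟩
    induction hp with
    | single => exact .refl
    | step hf hp ih =>
      rw [List.dropLast_cons_of_ne_nil hp.ne_nil] at hC
      simp only [List.mem_cons, forall_eq_or_imp] at hC
      exact .cons hC.1 hf (ih hC.2)

theorem exists_path_iff_via {P : Program L Var Val} {n m : L} :
    (∃ p, P.Path n m p) ↔ P.Via (fun _ => True) n m := by
  simp [via_iff_exists_path]

/-- The strict decrease in length drives the descent arguments about post-dominance. -/
theorem Path.exists_suffix {P : Program L Var Val} {n m x : L} {p : List L}
    (h : P.Path n m p) (hx : x ∈ p) (hne : x ≠ n) :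
    ∃ q, P.Path x m q ∧ q.length < p.length := by
  induction h with
  | single => simp_all
  | @step n k m p hf hp ih =>
    rcases List.mem_cons.1 hx with rfl | hx
    · exact absurd rfl hne
    · by_cases hk : x = k
      · subst hk
        exact ⟨p, hp, by simp⟩
      · obtain ⟨q, hq, hlen⟩ := ih hx hk
        exact ⟨q, hq, by simp; omega⟩

theorem Via.exists_path_append {P : Program L Var Val} {C : L → Prop} {n u m : L}
    {p : List L} (h : P.Via C n u) (hp : P.Path u m p) :
    ∃ q, P.Path n m q ∧ ∀ a ∈ q, C a ∨ a ∈ p := by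
  induction h using Relation.ReflTransGen.head_induction_on with
  | refl => exact ⟨p, hp, fun _ => .inr⟩
  | head h _ ih =>
    obtain ⟨q, hq, hC⟩ := ih
    refine ⟨_, .step h.2 hq, ?_⟩
    simpa [h.1] using hC

theorem bypass_iff {P : Program L Var Val} {N : Set L} {n m : L} {b : Option Bool} :
    P.Bypass N n b m ↔ ∃ k, P.edge n b k ∧ P.Via (· ∉ N) k m ∧ m ∈ N := by
  simp only [Bypass, via_iff_exists_path]
  constructor
  · rintro ⟨k, p, he, hp, hN, hm⟩
    exact ⟨k, he, ⟨p, hp, hN⟩, hm⟩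
  · rintro ⟨k, he, ⟨p, hp, hN⟩, hm⟩
    exact ⟨k, p, he, hp, hN, hm⟩

theorem reachingDef_iff {P : Program L Var Val} {d q : L} {v : Var} :
    P.ReachingDef d v q ↔ (P.stmt d).Defines v ∧
      ∃ k, P.Flow d k ∧ P.Via (fun a => ¬ (P.stmt a).Defines v) k q := by
  simp only [ReachingDef, via_iff_exists_path]
  constructor
  · rintro ⟨hd, k, p, hf, hp, h⟩
    exact ⟨hd, k, hf, p, hp, h⟩
  · rintro ⟨hd, k, hf, p, hp, h⟩
    exact ⟨hd, k, p, hf, hp, h⟩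

/-! ### Post-dominance and control dependence -/

theorem postDominates_exit (P : Program L Var Val) (n : L) : P.PostDominates P.exit n :=
  fun _ hp => hp.last_mem

theorem postDominates_self (P : Program L Var Val) (n : L) : P.PostDominates n n :=
  fun _ hp => hp.head_mem

/-- EXIT must be excluded because `Via` leaves the last node of the path unconstrained. -/
theorem postDominates_iff {P : Program L Var Val} {s n : L} (hs : s ≠ P.exit) :
    P.PostDominates s n ↔ ¬ P.Via (· ≠ s) n P.exit := by
  rw [via_iff_exists_path]
  constructor
  · rintro h ⟨p, hp, hne⟩
    rcases hp.mem_dropLast_or (h p hp) with h | h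
    · exact hne _ h rfl
    · exact hs h
  · intro h p hp
    by_contra hsp
    exact h ⟨p, hp, fun a ha h => hsp (h ▸ List.mem_of_mem_dropLast ha)⟩

/-- Two distinct nodes of `N` reached from `k` through nodes outside `N` cannot both
post-dominate `k`. -/
theorem not_postDominates_of_postDominates {P : Program L Var Val} {N : Set L} {k u v : L}
    (hu : u ∈ N) (hv : v ∈ N) (huv : u ≠ v) (hku : P.Via (· ∉ N) k u)
    (hkv : P.Via (· ∉ N) k v) (hue : ∃ p, P.Path u P.exit p) (hdu : P.PostDominates u k) :
    ¬ P.PostDominates v k := by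
  intro hdv
  obtain ⟨p, hp⟩ := hue
  -- Infinite descent on the path to EXIT, with `u` and `v` exchanging roles at each round.
  induction hlen : p.length using Nat.strong_induction_on generalizing u v p with
  | _ i ih =>
    obtain ⟨q, hq, hqN⟩ := hku.exists_path_append hp
    -- The nodes put in front of `p` lie outside `N`, so `v` occurs on `p` itself, behind `u`.
    have hvp := (hqN v (hdv q hq)).resolve_left (not_not_intro hv)
    obtain ⟨r, hr, hlt⟩ := hp.exists_suffix hvp huv.symm
    exact ih r.length (hlen ▸ hlt) hv hu huv.symm hkv hku hdv hdu r hr rfl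

/-- The walk starts at a node that `w` does not post-dominate and ends at `w`, which post-dominates
itself. The source of the first step that crosses over controls `w`. -/
theorem exists_controlDep_of_via {P : Program L Var Val} {C : L → Prop} {k w : L}
    (h : P.Via C k w) (hd : ¬ P.PostDominates w k) : ∃ c, C c ∧ P.ControlDep c w := by
  induction h using Relation.ReflTransGen.head_induction_on with
  | refl => exact absurd (P.postDominates_self w) hd
  | @head n m h _ ih =>
    by_cases hm : P.PostDominates w m
    · exact ⟨n, h.1, m, h.2, hm, fun hs => hd hs.1⟩
    · exact ih hm

/-- EXIT strictly post-dominates every other node. The case `d = P.exit` is real, because of the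
special edge EXIT → EXIT. -/
theorem eq_exit_of_controlDep_exit {P : Program L Var Val} {d : L}
    (h : P.ControlDep d P.exit) : d = P.exit := by
  obtain ⟨m, -, -, hs⟩ := h
  by_contra hd
  exact hs ⟨P.postDominates_exit d, hd⟩

theorem WellFormed.flow_mem {P : Program L Var Val} (hP : P.WellFormed)
    {n m : L} (h : P.Flow n m) : n ∈ P.nodes ∧ m ∈ P.nodes := by
  rcases h with ⟨b, hb⟩ | ⟨rfl, rfl⟩ | ⟨rfl, rfl⟩
  · exact hP.edge_mem _ _ _ hb
  · exact ⟨hP.entry_mem, hP.exit_mem⟩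
  · exact ⟨hP.exit_mem, hP.exit_mem⟩

theorem WellFormed.flow_ne_entry {P : Program L Var Val} (hP : P.WellFormed)
    {n m : L} (h : P.Flow n m) : m ≠ P.entry := by
  rcases h with ⟨b, hb⟩ | ⟨rfl, rfl⟩ | ⟨rfl, rfl⟩
  · exact hP.edge_ne_entry _ _ _ hb
  · exact hP.entry_ne_exit.symm
  · exact hP.entry_ne_exit.symm

theorem WellFormed.via_ne_entry {P : Program L Var Val} (hP : P.WellFormed)
    {C : L → Prop} {n m : L} (hn : n ≠ P.entry) (h : P.Via C n m) :
    m ≠ P.entry := by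
  rcases Relation.ReflTransGen.cases_tail h with rfl | ⟨_, _, h⟩
  · exact hn
  · exact hP.flow_ne_entry h.2

theorem WellFormed.edge_unique {P : Program L Var Val} (hP : P.WellFormed)
    {n m m' : L} {b : Option Bool} (h : P.edge n b m) (h' : P.edge n b m') :
    m = m' := by
  have hn := (hP.edge_mem _ _ _ h).1
  have hl := hP.edge_label _ _ _ h
  rcases b with _ | b
  · exact (hP.edge_uncond n hn (hP.edge_ne_exit _ _ _ h) (fun hc => hl.2 hc rfl)).unique h h'
  · exact (hP.edge_cond n hn (hl.1 (by simp)) b).unique h h'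

/-- With a single successor `m`, whatever post-dominates `m` post-dominates `c`, so only `s = c` is
left; then every path from `m` to EXIT returns to `c`, and EXIT would be unreachable. The special
edges are the reason for excluding ENTRY and EXIT. -/
theorem WellFormed.isCondition_of_controlDep {P : Program L Var Val} (hP : P.WellFormed)
    {c s : L} (h : P.ControlDep c s) (hentry : c ≠ P.entry)
    (hexit : c ≠ P.exit) : (P.stmt c).IsCondition := by
  by_contra hc
  obtain ⟨m, hf, hd, hs⟩ := h
  have huniq : ∀ {m'}, P.Flow c m' → P.edge c none m' := by
    rintro m' (⟨b, hb⟩ | ⟨h, -⟩ | ⟨h, -⟩)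
    · rcases b with _ | b
      · exact hb
      · exact absurd ((hP.edge_label _ _ _ hb).1 (by simp)) hc
    · exact absurd h hentry
    · exact absurd h hexit
  have hpath : ∀ p, P.Path c P.exit p → ∃ q, p = c :: q ∧ P.Path m P.exit q := by
    intro p hp
    cases hp with
    | single => exact absurd rfl hexit
    | @step _ m' _ q hf' hq =>
      obtain rfl := hP.edge_unique (huniq hf') (huniq hf)
      exact ⟨q, rfl, hq⟩
  have hdc : P.PostDominates s c := by
    intro p hp
    obtain ⟨q, rfl, hq⟩ := hpath p hp
    exact List.mem_cons_of_mem _ (hd q hq)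
  by_cases hcs : c = s
  · subst hcs
    -- A path from `c` to EXIT continues at `m` and must meet `c` again, which leaves a strictly
    -- shorter path from `c`.
    have hno : ∀ i p, p.length = i → ¬ P.Path c P.exit p := by
      intro i
      induction i using Nat.strong_induction_on with
      | _ i ih =>
        intro p hlen hp
        obtain ⟨q, rfl, hq⟩ := hpath p hp
        by_cases hcm : c = m
        · subst hcm
          exact ih q.length (by simp at hlen; omega) q rfl hq
        · obtain ⟨r, hr, hlt⟩ := hq.exists_suffix (hd q hq) hcm
          exact ih r.length (by simp at hlen; omega) r rfl hr
    obtain ⟨p, hp⟩ := hP.exit_reachable c (hP.flow_mem hf).1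
    exact hno _ p rfl hp
  · exact hs ⟨hdc, hcs⟩

theorem WellFormed.not_controlDep_entry {P : Program L Var Val} (hP : P.WellFormed)
    (d : L) : ¬ P.ControlDep d P.entry := by
  rintro ⟨m, hf, hd, -⟩
  obtain ⟨p, hp⟩ := hP.exit_reachable m (hP.flow_mem hf).2
  have hm := hP.flow_ne_entry hf
  have : ∀ {n p}, P.Path n P.exit p → n ≠ P.entry → P.entry ∉ p := by
    intro n p hp
    generalize P.exit = x at hp
    induction hp with
    | single => intro hn; simpa using hn.symm
    | step hf hp ih =>
      intro hn
      simp only [List.mem_cons, not_or]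
      exact ⟨hn.symm, ih (hP.flow_ne_entry hf)⟩
  exact this hp hm (hd p hp)

/-! ### Insertion of the SKIP statement -/

theorem WellFormed.augment {P : Program L Var Val} (hP : P.WellFormed) {l sk : L}
    (hl : l ∈ P.nodes) (hl_entry : l ≠ P.entry) (hsk : sk ∉ P.nodes) :
    (P.augment l sk).WellFormed := by
  have hne : ∀ {n}, n ∈ P.nodes → n ≠ sk := fun hn h => hsk (h ▸ hn)
  have hstmt : ∀ {n}, n ∈ P.nodes → (P.augment l sk).stmt n = P.stmt n := fun hn => by
    classical simp [Program.augment, Function.update_of_ne (hne hn)]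
  have hstmt' : (P.augment l sk).stmt sk = .skip := by simp [Program.augment]
  have hedge : ∀ {n b}, n ∈ P.nodes → (∃! m, P.edge n b m) →
      ∃! m, (P.augment l sk).edge n b m := by
    rintro n b hn ⟨m, hm, hu⟩
    have hn' := hne hn
    by_cases hml : m = l
    · subst hml
      refine ⟨sk, .inr (.inl ⟨hm, rfl⟩), ?_⟩
      rintro k (⟨h, h'⟩ | ⟨-, h⟩ | ⟨h, -⟩)
      · exact absurd (hu k h) h'
      · exact h
      · exact absurd h hn'
    · refine ⟨m, .inl ⟨hm, hml⟩, ?_⟩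
      rintro k (⟨h, h'⟩ | ⟨h, -⟩ | ⟨h, -⟩)
      · exact hu k h
      · exact absurd (hu l h).symm hml
      · exact absurd h hn'
  have hmem : ∀ {n b m}, (P.augment l sk).edge n b m →
      (n = sk ∧ b = none ∧ m = l) ∨ (n ∈ P.nodes ∧ m ∈ (P.augment l sk).nodes ∧
        m ≠ P.entry ∧ ∃ k, P.edge n b k) := by
    rintro n b m (⟨h, h'⟩ | ⟨h, rfl⟩ | ⟨h, h', rfl⟩)
    · exact .inr ⟨(hP.edge_mem _ _ _ h).1, .inr (hP.edge_mem _ _ _ h).2,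
        hP.edge_ne_entry _ _ _ h, m, h⟩
    · exact .inr ⟨(hP.edge_mem _ _ _ h).1, .inl rfl, (hne hP.entry_mem).symm, l, h⟩
    · exact .inl ⟨h, h', rfl⟩
  have hreach : ∀ n ∈ P.nodes, ∃ p, (P.augment l sk).Path n P.exit p := by
    intro n hn
    have h := exists_path_iff_via.1 (hP.exit_reachable n hn)
    rw [exists_path_iff_via]
    clear hn
    induction h using Relation.ReflTransGen.head_induction_on with
    | refl => exact .refl
    | @head n m h _ ih =>
      rcases h.2 with ⟨b, hb⟩ | h | h
      · by_cases hml : m = l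
        · subst hml
          exact .cons trivial (.inl ⟨b, .inr (.inl ⟨hb, rfl⟩)⟩)
            (.cons trivial (.inl ⟨none, .inr (.inr ⟨rfl, rfl, rfl⟩)⟩) ih)
        · exact .cons trivial (.inl ⟨b, .inl ⟨hb, hml⟩⟩) ih
      · exact .cons trivial (.inr (.inl h)) ih
      · exact .cons trivial (.inr (.inr h)) ih
  refine ⟨hP.finite.insert sk, .inr hP.entry_mem, .inr hP.exit_mem, hP.entry_ne_exit,
    (hstmt hP.entry_mem).trans hP.stmt_entry, (hstmt hP.exit_mem).trans hP.stmt_exit,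
    ?_, ?_, ?_, ?_, ?_, ?_, ?_⟩
  · intro n b m h
    rcases hmem h with ⟨rfl, -, rfl⟩ | ⟨hn, hm, -⟩
    · exact ⟨.inl rfl, .inr hl⟩
    · exact ⟨.inr hn, hm⟩
  · intro n b m h
    rcases hmem h with ⟨rfl, -, rfl⟩ | ⟨-, -, hm, -⟩
    · exact hl_entry
    · exact hm
  · intro n b m h
    rcases hmem h with ⟨rfl, -, rfl⟩ | ⟨-, -, -, k, hk⟩
    · exact (hne hP.exit_mem).symm
    · exact hP.edge_ne_exit _ _ _ hk
  · intro n b m h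
    rcases hmem h with ⟨rfl, rfl, rfl⟩ | ⟨hn, -, -, k, hk⟩
    · simp [hstmt', Stmt.IsCondition]
    · rw [hstmt hn]
      exact hP.edge_label _ _ _ hk
  · rintro n (rfl | hn) hc b
    · simp [hstmt', Stmt.IsCondition] at hc
    · rw [hstmt hn] at hc
      exact hedge hn (hP.edge_cond n hn hc b)
  · rintro n (rfl | hn) hx hc
    · refine ⟨l, .inr (.inr ⟨rfl, rfl, rfl⟩), ?_⟩
      intro k hk
      rcases hmem hk with ⟨-, -, h⟩ | ⟨h, -⟩
      · exact h
      · exact absurd h hsk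
    · rw [hstmt hn] at hc
      exact hedge hn (hP.edge_uncond n hn hx hc)
  · rintro n (rfl | hn)
    · obtain ⟨p, hp⟩ := hreach l hl
      exact ⟨_, .step (.inl ⟨none, .inr (.inr ⟨rfl, rfl, rfl⟩)⟩) hp⟩
    · exact hreach n hn

theorem IsConcrete.augment {P : Program L Var Val} (hP : P.IsConcrete) (l sk : L) :
    (P.augment l sk).IsConcrete := by
  intro n hn
  by_cases h : n = sk
  · subst h
    simp [Program.augment, Stmt.IsConcrete]
  · have hn' : n ∈ P.nodes := hn.resolve_left h
    classical simpa [Program.augment, Function.update_of_ne h] using hP n hn'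

/-! ### The retained nodes -/

/-- The nodes of the slice. -/
def retained (A : Program L Var Val) (l : L) (V : Set Var) : Set L :=
  A.VI l V ∪ A.AC l V ∪ {A.entry, A.exit}

/-- The set of all nodes satisfies the rules, and `VI` is contained in every such set. -/
theorem WellFormed.VI_subset_nodes {A : Program L Var Val} (hA : A.WellFormed) {l : L}
    (hl : l ∈ A.nodes) (V : Set Var) : A.VI l V ⊆ A.nodes := by
  have hDU : ∀ q X, A.DU q X ⊆ A.nodes := by
    rintro q X d ⟨v, -, -, k, -, hf, -⟩
    exact (hA.flow_mem hf).1
  exact fun s hs => hs _ ⟨hl, hDU _ _, fun _ _ => hDU _ _, fun c hc _ _ => hc⟩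

theorem WellFormed.retained_subset_nodes {A : Program L Var Val} (hA : A.WellFormed) {l : L}
    (hl : l ∈ A.nodes) (V : Set Var) : A.retained l V ⊆ A.nodes := by
  rintro n ((h | h) | rfl | rfl)
  · exact hA.VI_subset_nodes hl V h
  · exact h.1.1
  · exact hA.entry_mem
  · exact hA.exit_mem

theorem VI_subset_retained (A : Program L Var Val) (l : L) (V : Set Var) :
    A.VI l V ⊆ A.retained l V :=
  fun _ h => .inl (.inl h)

theorem exit_mem_retained (A : Program L Var Val) (l : L) (V : Set Var) :
    A.exit ∈ A.retained l V :=
  .inr (.inr rfl)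

theorem entry_mem_retained (A : Program L Var Val) (l : L) (V : Set Var) :
    A.entry ∈ A.retained l V :=
  .inr (.inl rfl)

theorem mem_VI_self (A : Program L Var Val) (l : L) (V : Set Var) : l ∈ A.VI l V :=
  fun _ hW => hW.skip

theorem mem_AC_or_mem_VI {A : Program L Var Val} {l c n : L} {V : Set Var} (hc : c ∈ A.nodes)
    (hcond : (A.stmt c).IsCondition) (hn : n ∈ A.VI l V ∪ A.AC l V)
    (h : A.TransControlDep c n) : c ∈ A.VI l V ∪ A.AC l V := by
  by_cases hcV : c ∈ A.VI l V
  · exact .inl hcV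
  · refine .inr ⟨⟨hc, hcond, ?_⟩, hcV⟩
    rcases hn with hn | ⟨⟨-, -, t, ht, hnt⟩, -⟩
    · exact ⟨n, hn, h⟩
    · exact ⟨t, ht, Relation.TransGen.trans h hnt⟩

/-- No deleted node controls a retained one. A controlling node other than ENTRY and EXIT is a
condition, and `AC` is defined through transitive dependence, so it absorbs the conditions above its
own members as well. -/
theorem WellFormed.mem_retained_of_controlDep {A : Program L Var Val} (hA : A.WellFormed)
    {l c n : L} {V : Set Var} (hn : n ∈ A.retained l V) (h : A.ControlDep c n) :
    c ∈ A.retained l V := by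
  by_cases hce : c = A.entry
  · exact hce ▸ A.entry_mem_retained l V
  by_cases hcx : c = A.exit
  · exact hcx ▸ A.exit_mem_retained l V
  have hc := hA.isCondition_of_controlDep h hce hcx
  rcases hn with hn | rfl | rfl
  · obtain ⟨m, hf, -⟩ := id h
    exact .inl (mem_AC_or_mem_VI (hA.flow_mem hf).1 hc hn (.single h))
  · exact absurd h (hA.not_controlDep_entry c)
  · exact absurd (eq_exit_of_controlDep_exit h) hcx

/-- Bypassing the deleted nodes from a given node leads to a unique retained node. -/
theorem WellFormed.via_retained_unique {A : Program L Var Val} (hA : A.WellFormed)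
    {l k u v : L} {V : Set Var} (hl : l ∈ A.nodes)
    (hku : A.Via (· ∉ A.retained l V) k u) (hkv : A.Via (· ∉ A.retained l V) k v)
    (hu : u ∈ A.retained l V) (hv : v ∈ A.retained l V) : u = v := by
  by_contra huv
  -- Otherwise a deleted node on the walk would control the retained `w`.
  have hd : ∀ w ∈ A.retained l V, A.Via (· ∉ A.retained l V) k w → A.PostDominates w k := by
    intro w hw hkw
    by_contra hd
    obtain ⟨c, hc, hcw⟩ := exists_controlDep_of_via hkw hd
    exact hc (hA.mem_retained_of_controlDep hw hcw)
  exact not_postDominates_of_postDominates hu hv huv hku hkv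
    (hA.exit_reachable u (hA.retained_subset_nodes hl V hu)) (hd u hu hku) (hd v hv hkv)

/-- EXIT is reachable and retained, so a path to it has a first retained node. -/
theorem WellFormed.exists_via_retained {A : Program L Var Val} (hA : A.WellFormed)
    {k l : L} (V : Set Var) (hk : k ∈ A.nodes) :
    ∃ u ∈ A.retained l V, A.Via (· ∉ A.retained l V) k u := by
  have h := exists_path_iff_via.1 (hA.exit_reachable k hk)
  clear hk
  induction h using Relation.ReflTransGen.head_induction_on with
  | refl => exact ⟨_, A.exit_mem_retained l V, .refl⟩
  | @head n m h _ ih =>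
    by_cases hn : n ∈ A.retained l V
    · exact ⟨n, hn, .refl⟩
    · obtain ⟨u, hu, hv⟩ := ih
      exact ⟨u, hu, .cons hn h.2 hv⟩

/-! ### The slice -/

theorem slice_edge_iff {A : Program L Var Val} {l n m : L} {V : Set Var} {b : Option Bool} :
    (A.slice l V).edge n b m ↔ n ∈ A.retained l V ∧
      ∃ k, A.edge n b k ∧ A.Via (· ∉ A.retained l V) k m ∧ m ∈ A.retained l V := by
  rw [← bypass_iff]
  rfl

theorem slice_stmt_of_mem_AC {A : Program L Var Val} {l n : L} {V : Set Var}
    (h : n ∈ A.AC l V) : (A.slice l V).stmt n = .star := by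
  simp [slice, h]

theorem slice_stmt_of_notMem_AC {A : Program L Var Val} {l n : L} {V : Set Var}
    (h : n ∉ A.AC l V) : (A.slice l V).stmt n = A.stmt n := by
  simp [slice, h]

theorem slice_stmt_of_mem_VI {A : Program L Var Val} {l n : L} {V : Set Var}
    (h : n ∈ A.VI l V) : (A.slice l V).stmt n = A.stmt n :=
  slice_stmt_of_notMem_AC fun h' => h'.2 h

theorem slice_isCondition_iff {A : Program L Var Val} {l n : L} {V : Set Var} :
    ((A.slice l V).stmt n).IsCondition ↔ (A.stmt n).IsCondition := by
  by_cases h : n ∈ A.AC l V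
  · rw [slice_stmt_of_mem_AC h]
    exact iff_of_true trivial h.1.2.1
  · rw [slice_stmt_of_notMem_AC h]

theorem slice_flow_iff {A : Program L Var Val} {l n m : L} {V : Set Var} :
    (A.slice l V).Flow n m ↔ n ∈ A.retained l V ∧
      ∃ k, A.Flow n k ∧ A.Via (· ∉ A.retained l V) k m ∧ m ∈ A.retained l V := by
  constructor
  · rintro (⟨b, hb⟩ | ⟨rfl, rfl⟩ | ⟨rfl, rfl⟩)
    · obtain ⟨hn, k, hk, hv, hm⟩ := slice_edge_iff.1 hb
      exact ⟨hn, k, .inl ⟨b, hk⟩, hv, hm⟩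
    · exact ⟨A.entry_mem_retained l V, A.exit, .inr (.inl ⟨rfl, rfl⟩), .refl,
        A.exit_mem_retained l V⟩
    · exact ⟨A.exit_mem_retained l V, A.exit, .inr (.inr ⟨rfl, rfl⟩), .refl,
        A.exit_mem_retained l V⟩
  · rintro ⟨hn, k, ⟨b, hb⟩ | ⟨rfl, rfl⟩ | ⟨rfl, rfl⟩, hv, hm⟩
    · exact .inl ⟨b, slice_edge_iff.2 ⟨hn, k, hb, hv, hm⟩⟩
    · obtain rfl := hv.eq_of_not (not_not_intro (A.exit_mem_retained l V))
      exact .inr (.inl ⟨rfl, rfl⟩)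
    · obtain rfl := hv.eq_of_not (not_not_intro (A.exit_mem_retained l V))
      exact .inr (.inr ⟨rfl, rfl⟩)

/-! ### Transfer of paths and control dependence to the slice -/

theorem exists_slice_via {A : Program L Var Val} {l n m : L} {V : Set Var} {C : L → Prop}
    (h : A.Via C n m) (hm : m ∈ A.retained l V) :
    ∃ u ∈ A.retained l V, A.Via (· ∉ A.retained l V) n u ∧ (A.slice l V).Via C u m := by
  induction h using Relation.ReflTransGen.head_induction_on with
  | refl => exact ⟨m, hm, .refl, .refl⟩
  | @head n k h _ ih =>
    obtain ⟨u, hu, hku, hum⟩ := ih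
    -- A retained `n` becomes the new start of the slice path; a deleted one only lengthens the
    -- bypass that leads to `u`.
    by_cases hn : n ∈ A.retained l V
    · exact ⟨n, hn, .refl, .cons h.1 (slice_flow_iff.2 ⟨hn, k, h.2, hku, hu⟩) hum⟩
    · exact ⟨u, hu, .cons hn h.2 hku, hum⟩

theorem slice_via {A : Program L Var Val} {l n m : L} {V : Set Var} {C : L → Prop}
    (h : A.Via C n m) (hn : n ∈ A.retained l V) (hm : m ∈ A.retained l V) :
    (A.slice l V).Via C n m := by
  obtain ⟨u, -, hu, hs⟩ := exists_slice_via h hm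
  obtain rfl := hu.eq_of_not (not_not_intro hn)
  exact hs

/-- The bypassed nodes reappear in the path of `A`, hence the demand that they satisfy `C`. -/
theorem via_of_slice_via {A : Program L Var Val} {l n m : L} {V : Set Var} {C : L → Prop}
    (hC : ∀ a ∉ A.retained l V, C a) (h : (A.slice l V).Via C n m) : A.Via C n m := by
  induction h using Relation.ReflTransGen.head_induction_on with
  | refl => exact .refl
  | @head n k h _ ih =>
    obtain ⟨-, j, hj, hjk, -⟩ := slice_flow_iff.1 h.2
    exact .cons h.1 hj ((hjk.mono hC).trans ih)

/-- A path to EXIT that avoids `s` transfers both ways, since the deleted nodes differ from the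
retained `s`. -/
theorem slice_postDominates_iff {A : Program L Var Val} {l s n : L} {V : Set Var}
    (hs : s ∈ A.retained l V) (hn : n ∈ A.retained l V) :
    (A.slice l V).PostDominates s n ↔ A.PostDominates s n := by
  by_cases hx : s = A.exit
  · subst hx
    exact iff_of_true ((A.slice l V).postDominates_exit n) (A.postDominates_exit n)
  · rw [postDominates_iff hx, postDominates_iff (P := A.slice l V) hx, not_iff_not]
    exact ⟨via_of_slice_via fun a ha h => ha (h ▸ hs),
      fun h => slice_via h hn (A.exit_mem_retained l V)⟩

theorem PostDominates.of_via {A : Program L Var Val} {s m u : L} {N : Set L} (hs : s ∈ N)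
    (h : A.PostDominates s m) (hv : A.Via (· ∉ N) m u) : A.PostDominates s u := by
  intro p hp
  obtain ⟨q, hq, hqN⟩ := hv.exists_path_append hp
  exact (hqN s (h q hq)).resolve_left (not_not_intro hs)

/-- The edge from `c` to `m` is replaced by the edge from `c` to the first retained node after `m`,
which `s` still post-dominates because no skipped node is `s`. -/
theorem WellFormed.slice_controlDep {A : Program L Var Val} (hA : A.WellFormed) {l c s : L}
    {V : Set Var} (hc : c ∈ A.retained l V) (hs : s ∈ A.retained l V)
    (h : A.ControlDep c s) : (A.slice l V).ControlDep c s := by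
  obtain ⟨m, hf, hd, hnot⟩ := h
  obtain ⟨u, hu, hmu⟩ := hA.exists_via_retained (l := l) V (hA.flow_mem hf).2
  refine ⟨u, slice_flow_iff.2 ⟨hc, m, hf, hmu, hu⟩,
    (slice_postDominates_iff hs hu).2 (hd.of_via hs hmu), ?_⟩
  rwa [StrictlyPostDominates, slice_postDominates_iff hs hc]

/-- Backward closure, applied from `s` upwards, keeps every intermediate node of the dependence
chain. -/
theorem WellFormed.slice_transControlDep {A : Program L Var Val} (hA : A.WellFormed)
    {l c s : L} {V : Set Var} (hs : s ∈ A.retained l V) (h : A.TransControlDep c s) :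
    c ∈ A.retained l V ∧ (A.slice l V).TransControlDep c s := by
  induction h using Relation.TransGen.head_induction_on with
  | single h =>
    have hc := hA.mem_retained_of_controlDep hs h
    exact ⟨hc, .single (hA.slice_controlDep hc hs h)⟩
  | head h _ ih =>
    have hc := hA.mem_retained_of_controlDep ih.1 h
    exact ⟨hc, .head (hA.slice_controlDep hc ih.1 h) ih.2⟩

theorem WellFormed.slice {A : Program L Var Val} (hA : A.WellFormed) {l : L}
    (hl : l ∈ A.nodes) (V : Set Var) : (A.slice l V).WellFormed := by
  have hN := hA.retained_subset_nodes hl V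
  have hedge : ∀ {n b}, n ∈ A.retained l V → (∃! m, A.edge n b m) →
      ∃! m, (A.slice l V).edge n b m := by
    rintro n b hn ⟨k, hk, huniq⟩
    obtain ⟨u, hu, hku⟩ := hA.exists_via_retained (l := l) V (hA.edge_mem _ _ _ hk).2
    refine ⟨u, slice_edge_iff.2 ⟨hn, k, hk, hku, hu⟩, ?_⟩
    intro v hv
    obtain ⟨-, k', hk', hkv, hv⟩ := slice_edge_iff.1 hv
    obtain rfl := huniq k' hk'
    exact hA.via_retained_unique hl hkv hku hv hu
  -- A skip is not a condition, so it is not in `AC`; this covers ENTRY and EXIT.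
  have hskip : ∀ n, A.stmt n = .skip → (A.slice l V).stmt n = .skip := by
    intro n hn
    rw [slice_stmt_of_notMem_AC, hn]
    intro h
    simpa [hn, Stmt.IsCondition] using h.1.2.1
  refine ⟨hA.finite.subset hN, A.entry_mem_retained l V, A.exit_mem_retained l V,
    hA.entry_ne_exit, hskip _ hA.stmt_entry, hskip _ hA.stmt_exit, ?_, ?_, ?_, ?_, ?_, ?_, ?_⟩
  · intro n b m h
    obtain ⟨hn, k, -, -, hm⟩ := slice_edge_iff.1 h
    exact ⟨hn, hm⟩
  · intro n b m h
    obtain ⟨-, k, hk, hv, -⟩ := slice_edge_iff.1 h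
    exact hA.via_ne_entry (hA.edge_ne_entry _ _ _ hk) hv
  · intro n b m h
    obtain ⟨-, k, hk, -, -⟩ := slice_edge_iff.1 h
    exact hA.edge_ne_exit _ _ _ hk
  · intro n b m h
    obtain ⟨-, k, hk, -, -⟩ := slice_edge_iff.1 h
    rw [slice_isCondition_iff]
    exact hA.edge_label _ _ _ hk
  · intro n hn hc b
    rw [slice_isCondition_iff] at hc
    exact hedge hn (hA.edge_cond n (hN hn) hc b)
  · intro n hn hx hc
    rw [slice_isCondition_iff] at hc
    exact hedge hn (hA.edge_uncond n (hN hn) hx hc)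
  · intro n hn
    exact exists_path_iff_via.2 (slice_via (exists_path_iff_via.1 (hA.exit_reachable n (hN hn)))
      hn (A.exit_mem_retained l V))

theorem slice_stmt_abstracts (A : Program L Var Val) (l n : L) (V : Set Var) :
    Stmt.Abstracts (A.stmt n) ((A.slice l V).stmt n) := by
  by_cases h : n ∈ A.AC l V
  · have hc := h.1.2.1
    rw [slice_stmt_of_mem_AC h]
    generalize A.stmt n = s at hc
    cases s with
    | cond e => exact .cond e
    | star => exact .same _
    | _ => exact hc.elim
  · rw [slice_stmt_of_notMem_AC h]
    exact .same _

theorem WellFormed.slice_isAbstractSubprogram {A : Program L Var Val} (hA : A.WellFormed)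
    {l : L} (hl : l ∈ A.nodes) (V : Set Var) : (A.slice l V).IsAbstractSubprogram A where
  wellFormed := hA.slice hl V
  nodes_subset := hA.retained_subset_nodes hl V
  entry_eq := rfl
  exit_eq := rfl
  stmt_abstracts n _ := A.slice_stmt_abstracts l n V
  edge_iff _ hn _ _ := ⟨fun h => h.2, fun h => ⟨hn, h⟩⟩
  structure_intact _ hn _ _ _ h := hA.slice_transControlDep hn h

end Program

/-! ### Effect of single steps -/

theorem Stmt.Abstracts.defines_iff {Var Val : Type*} {s t : Stmt Var Val} (h : s.Abstracts t)
    (v : Var) : t.Defines v ↔ s.Defines v := by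
  cases h <;> rfl

theorem Expr.eval_congr {Var Val T : Type*} {e : Expr Var Val T} {σ σ' : Var → Val}
    (h : ∀ v ∈ e.args, σ v = σ' v) : e.eval σ = e.eval σ' := by
  simp only [Expr.eval, List.map_congr_left h]

namespace Program

variable {L Var Val : Type*}

theorem Step.exists_edge {R : Program L Var Val} {n m : L} {σ ρ : Var → Val}
    (h : R.Step (n, σ) (m, ρ)) :
    ∃ b, R.edge n b m ∧ ∀ v, ¬ (R.stmt n).Defines v → ρ v = σ v := by
  cases h with
  | skip hs he => exact ⟨_, he, fun _ _ => rfl⟩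
  | assign hs he _ h => exact ⟨_, he, fun v hv => h v fun e => hv (by rw [hs]; exact e.symm)⟩
  | cond hs he => exact ⟨_, he, fun _ _ => rfl⟩
  | havoc hs he h => exact ⟨_, he, fun v hv => h v fun e => hv (by rw [hs]; exact e.symm)⟩
  | star hs he => exact ⟨_, he, fun _ _ => rfl⟩

/-- Two executions of a concrete statement from states that agree on the variables it reads. -/
theorem Step.agree {R R' : Program L Var Val} {n m m' : L} {σ σ' ρ ρ' : Var → Val}
    (h : R.Step (n, σ) (m, ρ)) (h' : R'.Step (n, σ') (m', ρ')) (hs : R'.stmt n = R.stmt n)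
    (hc : (R.stmt n).IsConcrete) (href : ∀ v ∈ (R.stmt n).ref, σ v = σ' v) :
    ∃ b, R.edge n b m ∧ R'.edge n b m' ∧ ∀ v, (R.stmt n).Defines v → ρ v = ρ' v := by
  cases h with
  | skip e he =>
    rw [e] at hs href ⊢
    cases h' <;> simp_all
    exact ⟨_, he, by assumption, fun v hv => hv.elim⟩
  | @assign _ _ x ex _ _ e he hx _ =>
    rw [e] at hs href ⊢
    cases h' with
    | assign e' he' hx' _ =>
      rw [e'] at hs
      cases hs
      refine ⟨_, he, he', ?_⟩
      rintro v rfl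
      rw [hx, hx']
      exact Expr.eval_congr href
    | _ => simp_all
  | cond e he =>
    rw [e] at hs href ⊢
    cases h' with
    | cond e' he' =>
      rw [e'] at hs
      cases hs
      rw [← Expr.eval_congr href] at he'
      exact ⟨_, he, he', fun v hv => hv.elim⟩
    | _ => simp_all
  | havoc e he => simp [e, Stmt.IsConcrete] at hc
  | star e he => simp [e, Stmt.IsConcrete] at hc

/-- A step at a concrete statement can be replayed by another program in a state that agrees
on the variables that the statement reads. -/
theorem Step.replay {R R' : Program L Var Val} {n m : L} {σ σ' ρ : Var → Val}
    (h : R.Step (n, σ) (m, ρ)) (hs : R'.stmt n = R.stmt n)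
    (hc : (R.stmt n).IsConcrete) (href : ∀ v ∈ (R.stmt n).ref, σ v = σ' v) :
    ∃ b ρ', R.edge n b m ∧ (∀ u, R'.edge n b u → R'.Step (n, σ') (u, ρ')) ∧
      ∀ v, ((R.stmt n).Defines v → ρ v = ρ' v) ∧ (¬ (R.stmt n).Defines v → ρ' v = σ' v) := by
  classical
  cases h with
  | skip e he =>
    rw [e]
    exact ⟨_, σ', he, fun u hu => .skip (hs.trans e) hu, fun v => ⟨False.elim, fun _ => rfl⟩⟩
  | @assign _ _ x ex _ _ e he hx _ =>
    rw [e] at href ⊢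
    refine ⟨_, Function.update σ' x (ex.eval σ'), he, fun u hu => .assign (hs.trans e) hu
      (by simp) fun y hy => by simp [hy], fun v => ⟨?_, fun hv => ?_⟩⟩
    · rintro rfl
      rw [hx, Function.update_self]
      exact Expr.eval_congr href
    · exact Function.update_of_ne (fun h => hv h.symm) _ _
  | cond e he =>
    rw [e] at href ⊢
    refine ⟨_, σ', he, fun u hu => .cond (hs.trans e) ?_, fun v => ⟨False.elim, fun _ => rfl⟩⟩
    rwa [← Expr.eval_congr href]
  | havoc e he => simp [e, Stmt.IsConcrete] at hc
  | star e he => simp [e, Stmt.IsConcrete] at hc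

/-! ### Relevant variables -/

/-- The variables whose value at `n` may be read, before they are redefined, by a
value-impacting statement or by the observation at `l`. -/
def relevant (A : Program L Var Val) (l : L) (V : Set Var) (n : L) : Set Var :=
  {v | ∃ q ∈ A.VI l V, (q = l ∧ v ∈ V ∨ v ∈ (A.stmt q).ref) ∧
    A.Via (fun a => ¬ (A.stmt a).Defines v) n q}

theorem ref_subset_relevant {A : Program L Var Val} {l n : L} {V : Set Var}
    (hn : n ∈ A.VI l V) : (A.stmt n).ref ⊆ A.relevant l V n :=
  fun _ hv => ⟨n, hn, .inr hv, .refl⟩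

theorem subset_relevant_self (A : Program L Var Val) (l : L) (V : Set Var) :
    V ⊆ A.relevant l V l :=
  fun _ hv => ⟨l, A.mem_VI_self l V, .inl ⟨rfl, hv⟩, .refl⟩

theorem mem_relevant_of_flow {A : Program L Var Val} {l n m : L} {V : Set Var} {v : Var}
    (hf : A.Flow n m) (hv : v ∈ A.relevant l V m) (hn : ¬ (A.stmt n).Defines v) :
    v ∈ A.relevant l V n := by
  obtain ⟨q, hq, hr, h⟩ := hv
  exact ⟨q, hq, hr, .cons hn hf h⟩

/-- The witness of relevance is a use that the definition at `n` reaches, so one of the two data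
rules applies. Arguing in each closed set separately avoids the question whether `VI` is closed. -/
theorem mem_VI_of_defines {A : Program L Var Val} {l n m : L} {V : Set Var} {v : Var}
    (hf : A.Flow n m) (hv : v ∈ A.relevant l V m) (hn : (A.stmt n).Defines v) :
    n ∈ A.VI l V := by
  obtain ⟨q, hq, hr, h⟩ := hv
  have hd : A.ReachingDef n v q := reachingDef_iff.2 ⟨hn, m, hf, h⟩
  intro W hW
  rcases hr with ⟨rfl, hv⟩ | hv
  · exact hW.crit n ⟨v, hv, hd⟩
  · exact hW.data q (hq W hW) n ⟨v, hv, hd⟩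

theorem relevant_subset_of_via {A : Program L Var Val} {l n m : L} {V : Set Var}
    (h : A.Via (· ∉ A.VI l V) n m) : A.relevant l V m ⊆ A.relevant l V n := by
  induction h using Relation.ReflTransGen.head_induction_on with
  | refl => exact subset_rfl
  | head h _ ih =>
    exact fun v hv => mem_relevant_of_flow h.2 (ih hv)
      fun hd => h.1 (mem_VI_of_defines h.2 (ih hv) hd)

theorem traceWindow_cons (l : L) (V : Set Var) (s : L × (Var → Val))
    (τ : List (L × (Var → Val))) [Decidable (s.1 = l)] :
    traceWindow l V (s :: τ) =
      if s.1 = l then (fun v : V => s.2 v) :: traceWindow l V τ else traceWindow l V τ := by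
  by_cases h : s.1 = l <;> simp [traceWindow, h]

/-! ### Every trace is matched by a trace of the slice -/

/-- Induction along the trace. Since `n` may be deleted, the matching run starts at the retained
node to which bypassing leads from `n`; the invariant is agreement on the variables relevant at `n`.
-/
theorem WellFormed.exists_slice_chain {A : Program L Var Val} (hA : A.WellFormed)
    (hconc : A.IsConcrete) {l : L} (hl : l ∈ A.nodes) (hlx : l ≠ A.exit) (V : Set Var)
    {τ : List (L × (Var → Val))} {θ : Var → Val} (hτ : τ.IsChain A.Step)
    (hlast : τ.getLast? = some (A.exit, θ)) {n : L} {σ σ' : Var → Val}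
    (hhead : τ.head? = some (n, σ)) (hσ : ∀ v ∈ A.relevant l V n, σ v = σ' v) :
    ∃ u ∈ A.retained l V, ∃ τ', A.Via (· ∉ A.retained l V) n u ∧
      τ'.head? = some (u, σ') ∧ τ'.IsChain (A.slice l V).Step ∧
      (∃ θ', τ'.getLast? = some (A.exit, θ')) ∧ traceWindow l V τ = traceWindow l V τ' := by
  classical
  induction τ generalizing n σ σ' with
  | nil => simp at hhead
  | cons s τ ih =>
    obtain rfl : s = (n, σ) := by simpa using hhead
    rcases τ with _ | ⟨⟨m, ρ⟩, τ⟩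
    · obtain ⟨rfl, -⟩ : n = A.exit ∧ σ = θ := by simpa using hlast
      refine ⟨_, A.exit_mem_retained l V, [(A.exit, σ')], .refl, rfl, by simp, ⟨σ', rfl⟩, ?_⟩
      simp [traceWindow, hlx.symm]
    · rw [List.isChain_cons_cons] at hτ
      obtain ⟨hstep, hτ⟩ := hτ
      rw [List.getLast?_cons_cons] at hlast
      obtain ⟨b₀, he₀, hσρ⟩ := hstep.exists_edge
      have hf : A.Flow n m := .inl ⟨b₀, he₀⟩
      have hwin : ∀ {τ' : List (L × (Var → Val))},
          traceWindow l V ((m, ρ) :: τ) = traceWindow l V τ' →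
          traceWindow l V ((n, σ) :: (m, ρ) :: τ) = traceWindow l V ((n, σ') :: τ') := by
        intro τ' h
        rw [traceWindow_cons, traceWindow_cons l V (n, σ'), h]
        split_ifs with hn
        · obtain rfl : n = l := hn
          congr 1
          ext v
          exact hσ v (A.subset_relevant_self n V v.2)
        · rfl
      -- The case of a retained `n`: one step of the slice at `n` is put in front of the run that
      -- matches the rest of the trace.
      have hextend : ∀ b ρ', A.edge n b m → n ∈ A.retained l V →
          (∀ u, (A.slice l V).edge n b u → (A.slice l V).Step (n, σ') (u, ρ')) →
          (∀ v ∈ A.relevant l V m, ρ v = ρ' v) →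
          ∃ u ∈ A.retained l V, ∃ τ', A.Via (· ∉ A.retained l V) n u ∧
          τ'.head? = some (u, σ') ∧ τ'.IsChain (A.slice l V).Step ∧
          (∃ θ', τ'.getLast? = some (A.exit, θ')) ∧
          traceWindow l V ((n, σ) :: (m, ρ) :: τ) = traceWindow l V τ' := by
        intro b ρ' he hn hst hρ
        obtain ⟨u, hu, τ', hmu, hh, hch, ⟨θ', hl'⟩, hw⟩ := ih hτ hlast rfl hρ
        rcases τ' with _ | ⟨s, τ'⟩
        · simp at hh
        · obtain rfl : s = (u, ρ') := by simpa using hh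
          exact ⟨n, hn, (n, σ') :: (u, ρ') :: τ', .refl, rfl,
            List.isChain_cons_cons.2 ⟨hst u (slice_edge_iff.2 ⟨hn, m, he, hmu, hu⟩), hch⟩,
            ⟨θ', by rw [List.getLast?_cons_cons]; exact hl'⟩, hwin hw⟩
      have hnd : ∀ v ∈ A.relevant l V m, ¬ (A.stmt n).Defines v → ρ v = σ' v := fun v hv hd =>
        (hσρ v hd).trans (hσ v (mem_relevant_of_flow hf hv hd))
      by_cases hn : n ∈ A.retained l V
      · by_cases hAC : n ∈ A.AC l V
        · have hcond := hAC.1.2.1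
          obtain ⟨b, rfl⟩ := Option.ne_none_iff_exists'.1 ((hA.edge_label _ _ _ he₀).2 hcond)
          refine hextend _ σ' he₀ hn (fun u hu => .star (slice_stmt_of_mem_AC hAC) hu)
            fun v hv => hnd v hv fun hd => ?_
          generalize A.stmt n = s at hcond hd
          cases s <;> first | exact hd | exact hcond
        · have hnA := hA.retained_subset_nodes hl V hn
          have href : ∀ v ∈ (A.stmt n).ref, σ v = σ' v := by
            rcases hn with (hn | hn) | rfl | rfl
            · exact fun v hv => hσ v (ref_subset_relevant hn hv)
            · exact absurd hn hAC
            · rw [hA.stmt_entry]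
              exact fun v hv => hv.elim
            · exact absurd rfl (hA.edge_ne_exit _ _ _ he₀)
          obtain ⟨b, ρ', he, hst, hρ⟩ :=
            hstep.replay (slice_stmt_of_notMem_AC (l := l) (V := V) hAC) (hconc n hnA) href
          refine hextend b ρ' he hn hst fun v hv => ?_
          by_cases hd : (A.stmt n).Defines v
          · exact (hρ v).1 hd
          · rw [hnd v hv hd, (hρ v).2 hd]
      · have hnV : n ∉ A.VI l V := fun h => hn (A.VI_subset_retained l V h)
        -- A deleted node defines no relevant variable, so the slice stays where it is.
        obtain ⟨u, hu, τ', hmu, hh, hch, hl', hw⟩ := ih hτ hlast rfl fun v hv =>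
          hnd v hv fun hd => hnV (mem_VI_of_defines hf hv hd)
        refine ⟨u, hu, τ', .cons hn hf hmu, hh, hch, hl', ?_⟩
        rw [traceWindow_cons, if_neg fun h : n = l => hnV (h ▸ A.mem_VI_self l V), hw]

/-! ### Executions agree at the value-impacting statements -/

/-- Up to nodes outside `W`, the edges of `R` are those of `A`, and the statements of `R` are
those of `A`, or abstract versions of them outside `W`. -/
structure Follows (R A : Program L Var Val) (W : Set L) : Prop where
  edge : ∀ n b m, R.edge n b m → ∃ k, A.edge n b k ∧ A.Via (· ∉ W) k m
  stmt : ∀ n, Stmt.Abstracts (A.stmt n) (R.stmt n)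
  stmt_eq : ∀ n ∈ W, R.stmt n = A.stmt n

theorem follows_self (A : Program L Var Val) (W : Set L) : A.Follows A W :=
  ⟨fun _ _ m h => ⟨m, h, .refl⟩, fun _ => .same _, fun _ _ => rfl⟩

theorem slice_follows (A : Program L Var Val) (l : L) (V : Set Var) :
    (A.slice l V).Follows A (A.VI l V) where
  edge n b m h := by
    obtain ⟨-, k, hk, hv, -⟩ := slice_edge_iff.1 h
    exact ⟨k, hk, hv.mono fun _ ha h => ha (A.VI_subset_retained l V h)⟩
  stmt n := A.slice_stmt_abstracts l n V
  stmt_eq _ hn := slice_stmt_of_mem_VI hn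

/-- An execution that visits `l` reaches a first value-impacting statement, with the values of
the variables that are relevant there unchanged. -/
theorem Follows.exists_first {R A : Program L Var Val} {l : L} {V : Set Var}
    (hR : R.Follows A (A.VI l V)) {τ : List (L × (Var → Val))} {n : L} {σ : Var → Val}
    (hτ : ((n, σ) :: τ).IsChain R.Step) (hw : traceWindow l V ((n, σ) :: τ) ≠ []) :
    A.Via (fun _ => True) n l ∧ ∃ u ∈ A.VI l V, ∃ ρ τ', A.Via (· ∉ A.VI l V) n u ∧
      A.Via (fun _ => True) u l ∧ ((u, ρ) :: τ').IsChain R.Step ∧ τ'.length ≤ τ.length ∧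
      traceWindow l V ((u, ρ) :: τ') = traceWindow l V ((n, σ) :: τ) ∧
      ∀ v ∈ A.relevant l V u, ρ v = σ v := by
  classical
  induction τ generalizing n σ with
  | nil =>
    rw [traceWindow_cons] at hw
    by_cases hn : n = l
    · subst hn
      exact ⟨.refl, n, A.mem_VI_self n V, σ, [], .refl, .refl, hτ, le_rfl, rfl, fun _ _ => rfl⟩
    · simp [hn, traceWindow] at hw
  | cons s τ ih =>
    obtain ⟨m, ρ⟩ := s
    by_cases hnl : n = l
    · subst hnl
      exact ⟨.refl, n, A.mem_VI_self n V, σ, _, .refl, .refl, hτ, le_rfl, rfl, fun _ _ => rfl⟩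
    have hτ' := List.isChain_cons_cons.1 hτ
    have hwin : traceWindow l V ((n, σ) :: (m, ρ) :: τ) = traceWindow l V ((m, ρ) :: τ) := by
      rw [traceWindow_cons, if_neg hnl]
    obtain ⟨hml, u, hu, ρ', τ', hmu, hul, hch, hlen, hw', hρ⟩ := ih hτ'.2 (hwin ▸ hw)
    obtain ⟨b, he, hst⟩ := hτ'.1.exists_edge
    obtain ⟨k, hk, hkm⟩ := hR.edge _ _ _ he
    have hf : A.Flow n k := .inl ⟨b, hk⟩
    -- Reachability of `l` is recorded because the first value-impacting node is unique only among
    -- paths that reach `l`.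
    have hnl' : A.Via (fun _ => True) n l :=
      .cons trivial hf ((hkm.mono fun _ _ => trivial).trans hml)
    refine ⟨hnl', ?_⟩
    by_cases hn : n ∈ A.VI l V
    · exact ⟨n, hn, σ, _, .refl, hnl', hτ, le_rfl, rfl, fun _ _ => rfl⟩
    · refine ⟨u, hu, ρ', τ', .cons hn hf (hkm.trans hmu), hul, hch, by simp; omega,
        hw'.trans hwin.symm, fun v hv => (hρ v hv).trans (hst v fun hd => hn ?_)⟩
      exact mem_VI_of_defines hf (relevant_subset_of_via (hkm.trans hmu) hv)
        (((hR.stmt n).defines_iff v).1 hd)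

theorem _root_.FirstIn.unique {L : Type*} {t u : L} {W : Set L} {p : List L} (ht : FirstIn W t p)
    (hu : FirstIn W u p) : t = u := by
  obtain ⟨a, b, rfl, ha, ht⟩ := ht
  obtain ⟨a', b', h, ha', hu⟩ := hu
  induction a generalizing a' with
  | nil =>
    rcases a' with _ | ⟨x, a'⟩
    · simp only [List.nil_append, List.cons.injEq] at h
      exact h.1
    · simp only [List.nil_append, List.cons_append, List.cons.injEq] at h
      exact absurd (h.1 ▸ ht) (ha' x (by simp))
  | cons y a ih =>
    rcases a' with _ | ⟨x, a'⟩
    · simp only [List.nil_append, List.cons_append, List.cons.injEq] at h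
      exact absurd (h.1 ▸ hu) (ha y (by simp))
    · simp only [List.cons_append, List.cons.injEq] at h
      exact ih (fun x hx => ha x (by simp [hx])) _ h.2 (fun x hx => ha' x (by simp [hx]))

theorem Via.exists_path_firstIn {A : Program L Var Val} {W : Set L} {n u m : L}
    (h : A.Via (· ∉ W) n u) (hu : u ∈ W) (hum : A.Via (fun _ => True) u m) :
    ∃ p, A.Path n m p ∧ FirstIn W u p := by
  induction h using Relation.ReflTransGen.head_induction_on with
  | refl =>
    obtain ⟨p, hp⟩ := exists_path_iff_via.2 hum
    refine ⟨p, hp, ?_⟩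
    cases hp with
    | single => exact ⟨[], [], rfl, by simp, hu⟩
    | step => exact ⟨[], _, rfl, by simp, hu⟩
  | head h _ ih =>
    obtain ⟨p, hp, a, b, rfl, ha, hu⟩ := ih
    exact ⟨_, .step h.2 hp, _ :: a, b, rfl, by simpa using ⟨h.1, ha⟩, hu⟩

/-- The first value-impacting statement on the way to `l` is unique. -/
theorem WellFormed.via_VI_unique {A : Program L Var Val} (hA : A.WellFormed) {l k u v : L}
    {V : Set Var} (hlx : l ≠ A.exit) (hku : A.Via (· ∉ A.VI l V) k u)
    (hkv : A.Via (· ∉ A.VI l V) k v) (hu : u ∈ A.VI l V) (hv : v ∈ A.VI l V)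
    (hul : A.Via (fun _ => True) u l) (hvl : A.Via (fun _ => True) v l) : u = v := by
  by_cases hk : k ∈ A.VI l V
  · rw [hku.eq_of_not (not_not_intro hk), hkv.eq_of_not (not_not_intro hk)]
  obtain ⟨p, hp, hpu⟩ := hku.exists_path_firstIn hu hul
  obtain ⟨q, hq, hqv⟩ := hkv.exists_path_firstIn hv hvl
  obtain ⟨w, a, b, a', b', hpe, hqe, hw, ha, ha', -⟩ :=
    (valueImpactClosed_VI hA hlx V).firstIn_unique hA hlx hp hk hq
  exact (hpu.unique ⟨a, b, hpe, ha, hw⟩).trans (hqv.unique ⟨a', b', hqe, ha', hw⟩).symm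

/-- Bypasses of different lengths can put the two runs at different nodes, so both are anchored at a
common node `k` of `A`, from which each is reached outside `VI`. `Follows` lets each run belong to
the program or to the slice. -/
theorem WellFormed.window_agree {A : Program L Var Val} (hA : A.WellFormed)
    (hconc : A.IsConcrete) {l : L} (hl : l ∈ A.nodes) (hlx : l ≠ A.exit) {V : Set Var}
    {R R' : Program L Var Val} (hR : R.Follows A (A.VI l V)) (hR' : R'.Follows A (A.VI l V))
    {τ τ' : List (L × (Var → Val))} {k n n' : L} {σ σ' : Var → Val}
    (hτ : ((n, σ) :: τ).IsChain R.Step) (hτ' : ((n', σ') :: τ').IsChain R'.Step)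
    (hkn : A.Via (· ∉ A.VI l V) k n) (hkn' : A.Via (· ∉ A.VI l V) k n')
    (hσ : ∀ v ∈ A.relevant l V k, σ v = σ' v) {i : ℕ} {w w' : V → Val}
    (hw : (traceWindow l V ((n, σ) :: τ))[i]? = some w)
    (hw' : (traceWindow l V ((n', σ') :: τ'))[i]? = some w') : w = w' := by
  classical
  -- The index `i` varies too, since passing `l` uses up one entry of each window.
  induction hlen : τ.length using Nat.strong_induction_on
    generalizing τ τ' k n n' σ σ' i with
  | _ N ih =>
    obtain ⟨-, u, hu, ρ, t, hnu, hul, hch, hle, hwin, hρ⟩ :=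
      hR.exists_first hτ (by rintro h; simp [h] at hw)
    obtain ⟨-, u', hu', ρ', t', hnu', hul', hch', -, hwin', hρ'⟩ :=
      hR'.exists_first hτ' (by rintro h; simp [h] at hw')
    obtain rfl := hA.via_VI_unique hlx (hkn.trans hnu) (hkn'.trans hnu') hu hu' hul hul'
    rw [← hwin] at hw
    rw [← hwin'] at hw'
    have hρρ : ∀ v ∈ A.relevant l V u, ρ v = ρ' v := fun v hv => by
      rw [hρ v hv, hρ' v hv]
      exact hσ v (relevant_subset_of_via (hkn.trans hnu) hv)
    -- What remains after `u`: equal reads force the same label, so both runs follow the same edge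
    -- of `A`, and its target `c` is the next common anchor.
    have hnext : ∀ j : ℕ, (traceWindow l V t)[j]? = some w → (traceWindow l V t')[j]? = some w' →
        w = w' := by
      intro j hj hj'
      rcases t with _ | ⟨⟨m, μ⟩, t⟩
      · simp [traceWindow] at hj
      rcases t' with _ | ⟨⟨m', μ'⟩, t'⟩
      · simp [traceWindow] at hj'
      obtain ⟨hstep, hch⟩ := List.isChain_cons_cons.1 hch
      obtain ⟨hstep', hch'⟩ := List.isChain_cons_cons.1 hch'
      have hs := hR.stmt_eq u hu
      have hs' := hR'.stmt_eq u hu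
      obtain ⟨b, he, he', hdef⟩ := hstep.agree hstep' (hs'.trans hs.symm)
        (hs ▸ hconc u (hA.VI_subset_nodes hl V hu))
        fun v hv => hρρ v (ref_subset_relevant hu (hs ▸ hv))
      obtain ⟨c, hc, hcm⟩ := hR.edge _ _ _ he
      obtain ⟨c', hc', hcm'⟩ := hR'.edge _ _ _ he'
      obtain rfl := hA.edge_unique hc hc'
      obtain ⟨-, -, hnd⟩ := hstep.exists_edge
      obtain ⟨-, -, hnd'⟩ := hstep'.exists_edge
      refine ih t.length (by simp at hle; omega) hch hch' hcm hcm' (fun v hv => ?_) hj hj' rfl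
      by_cases hd : (R.stmt u).Defines v
      · exact hdef v hd
      · rw [hnd v hd, hnd' v (by rwa [hs', ← hs])]
        exact hρρ v (mem_relevant_of_flow (.inl ⟨b, hc⟩) hv (hs ▸ hd))
    rw [traceWindow_cons] at hw hw'
    by_cases h : u = l
    · rw [if_pos h] at hw hw'
      subst h
      rcases i with _ | i
      · simp only [List.getElem?_cons_zero, Option.some.injEq] at hw hw'
        rw [← hw, ← hw']
        ext v
        exact hρρ v (A.subset_relevant_self u V v.2)
      · exact hnext i hw hw'
    · rw [if_neg h] at hw hw'
      exact hnext i hw hw'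

/-! ### The data slice property -/

theorem WellFormed.slice_isDataSlice {A : Program L Var Val} (hA : A.WellFormed)
    (hconc : A.IsConcrete) {l : L} (hl : l ∈ A.nodes) (hlx : l ≠ A.exit)
    (hskip : A.stmt l = .skip) (V : Set Var) : (A.slice l V).IsDataSlice A l V where
  isAbstractSubprogram := hA.slice_isAbstractSubprogram hl V
  skip_retained := ⟨A.VI_subset_retained l V (A.mem_VI_self l V),
    (slice_stmt_of_mem_VI (A.mem_VI_self l V)).trans hskip⟩
  exists_equivalent I τ hτ := by
    obtain ⟨hhead, hch, θ, hlast⟩ := hτ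
    obtain ⟨u, -, τ', hv, hh, hch', hlast', hw⟩ :=
      hA.exists_slice_chain hconc hl hlx V hch hlast hhead fun _ _ => rfl
    -- ENTRY is retained, so the bypass that starts there is trivial and the matching run starts at
    -- ENTRY.
    obtain rfl := hv.eq_of_not (not_not_intro (A.entry_mem_retained l V))
    exact ⟨τ', ⟨hh, hch', hlast'⟩, hw⟩
  corresponding_agree I τ τ' hτ hτ' i w w' hw hw' := by
    obtain ⟨hhead, hch, -⟩ := hτ
    obtain ⟨hhead', hch', -⟩ := hτ'
    obtain ⟨τ, rfl⟩ := List.head?_eq_some_iff.1 hhead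
    obtain ⟨τ', rfl⟩ := List.head?_eq_some_iff.1 hhead'
    exact hA.window_agree hconc hl hlx (A.follows_self _) (A.slice_follows l V) hch hch'
      .refl .refl (fun _ _ => rfl) hw hw'

end Program

theorem theorem1 {L Var Val : Type*} (P : Program L Var Val)
    (hP : P.WellFormed) (hconcrete : P.IsConcrete)
    (l sk : L) (hl : l ∈ P.nodes) (hl_entry : l ≠ P.entry) (hsk : sk ∉ P.nodes)
    (V : Set Var) :
    ((P.augment l sk).slice sk V).IsDataSlice (P.augment l sk) sk V :=
  (hP.augment hl hl_entry hsk).slice_isDataSlice (hconcrete.augment l sk) (.inl rfl)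
    -- The criterion is the fresh node `sk`, which differs from EXIT even if `l` is EXIT.
    (fun h => hsk (h ▸ hP.exit_mem)) (by classical simp [Program.augment]) V
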